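/- Let $D=(V,A)$ be a finite directed graph in which every arc $a$ has a capacity $u_a>0$, a transit time $\tau_a\ge 0$ and a cost $c_a\in\mathbb{R}$, and suppose that $D$ has no directed cycle of negative total cost. Let $S^+\subseteq V$ (sources) and $S^-\subseteq V\setminus S^+$ (sinks) be given with supplies $b_s>0$ for $s\in S^+$ and demands $-b_t>0$ for $t\in S^-$ such that $\sum_{s\in S^+}b_s+\sum_{t\in S^-}b_t=0$. A flow over time with time horizon $\theta\ge 0$ consists of Lebesgue-measurable inflow rates $f_a:[0,\theta-\tau_a)\to[0,u_a]$, $a\in A$ (extended by zero to $\mathbb{R}$). The excess of a node $v$ at time $r$ is $$\mathrm{ex}_f(v,r)=\sum_{a\text{ entering }v}\int_0^{\max(r-\tau_a,0)}f_a(x)\,dx-\sum_{a\text{ leaving }v}\int_0^{r}f_a(x)\,dx .$$ It is required that $\mathrm{ex}_f(v,r)\ge 0$ for all $v\in V\setminus S^+$ and $r\in[0,\theta]$, and that $\mathrm{ex}_f(v,\theta)=0$ for all $v\in V\setminus(S^+\cup S^-)$; in the model without storage at intermediate nodes, also $\mathrm{ex}_f(v,r)=0$ for all $v\in V\setminus (S^+\cup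 S^-)$ and $r\in[0,\theta]$. It is a transshipment over time if moreover $\mathrm{ex}_f(v,\theta)=-b_v$ for all $v\in S^+\cup S^-$. Its cost is $\sum_{a\in A}c_a\int_0^{\max(\theta-\tau_a,0)}f_a(x)\,dx$, and it has minimum cost if no transshipment over time, with any time horizon, is cheaper. A flow over time $f$ with time horizon $\theta$ sends a positive amount of flow from $s\in S^+$ to $t\in S^-$ if it can be written as $f=\sum_{s'\in S^+,\,t'\in S^-}g^{s't'}$, where each $g^{s't'}$ is a flow over time with time horizon $\theta$ with the single source $s'$ and the single sink $t'$ (storage at other nodes being allowed in $g^{s't'}$), and $\mathrm{ex}_{g^{st}}(t,\theta)>0$. Let $\bar A$ be the set of all pairs $st\in S^+\times S^-$ such that $D$ has an $s$-$t$-path, and for $st\in\bar A$ let $\bar c_{st}$ be the cost of a cheapest $s$-$t$-path in $D$. The static transportation problem on $\bar D=(S^+\cup S^-,\bar A)$ is to minimize $\sum_{st\in\bar A}\bar c_{st}x_{st}$ subject to $\sum_{t:\,st\in\bar A}x_{st}=b_s$ for all $s\in S^+$, $\sum_{s:\,st\in\bar A}-x_{st}=b_t$ for all $t\in S^-$, and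 $x_{st}\ge 0$ for all $st\in\bar A$. Then, both in the model with and in the model without storage at intermediate nodes: (i) The transportation problem on $\bar D$ has a feasible solution if and only if there exists a transshipment over time in $D$ (with some time horizon). (ii) In this case, both the minimum cost of a feasible solution to the transportation problem and the minimum cost of a transshipment over time in $D$ are attained, and they are equal. (iii) For all $s\in S^+$ and $t\in S^-$, there is a minimum cost transshipment over time in $D$ that sends a positive amount of flow from $s$ to $t$ if and only if $st\in\bar A$ and there is an optimal solution $x$ to the transportation problem with $x_{st}>0$. -/

import Mathlib

namespace TransOverTime

/-- A finite directed graph with node set `V` and arc set `A` (parallel arcs and loops are allowed)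
whose arcs carry a positive capacity, a non-negative transit time and a cost coefficient. -/
structure Network (V A : Type*) where
  tail : A → V
  head : A → V
  capacity : A → ℝ
  transit : A → ℝ
  cost : A → ℝ
  capacity_pos : ∀ a, 0 < capacity a
  transit_nonneg : ∀ a, 0 ≤ transit a

namespace Network

variable {V A : Type*}

/-- `D.IsWalk v w P`: the list `P` of arcs is a directed walk from `v` to `w`. -/
def IsWalk (D : Network V A) : V → V → List A → Prop
  | v, w, [] => v = w
  | v, w, a :: P => D.tail a = v ∧ IsWalk D (D.head a) w P

/-- A directed `v`-`w`-path: a walk that visits no node twice. -/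
def IsPath (D : Network V A) (v w : V) (P : List A) : Prop :=
  D.IsWalk v w P ∧ (v :: P.map D.head).Nodup

/-- A directed cycle: a nonempty closed walk that visits no node twice, except that it returns to
its start. -/
def IsCycle (D : Network V A) (P : List A) : Prop :=
  P ≠ [] ∧ (∃ v, D.IsWalk v v P) ∧ (P.map D.head).Nodup

/-- The cost `c(P)` of a list of arcs. -/
def listCost (D : Network V A) (P : List A) : ℝ := (P.map D.cost).sum

/-- The arc costs are conservative: there is no cycle of negative cost. -/
def Conservative (D : Network V A) : Prop := ∀ P, D.IsCycle P → 0 ≤ D.listCost P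

/-- The cost of a cheapest `v`-`w`-path (used only if there is a `v`-`w`-path; the infimum is then
a minimum, see `exists_isPath_listCost_eq`). -/
noncomputable def pathCost (D : Network V A) (v w : V) : ℝ :=
  sInf {z | ∃ P, D.IsPath v w P ∧ D.listCost P = z}

theorem finite_isPath [Finite V] [Finite A] (D : Network V A) (v w : V) :
    {P | D.IsPath v w P}.Finite := by
  have := Fintype.ofFinite V
  refine (List.finite_length_le A (Fintype.card V)).subset ?_
  intro P hP
  have h := hP.2.length_le_card
  simp only [List.length_cons, List.length_map] at h
  show P.length ≤ Fintype.card V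
  omega

theorem exists_isPath_listCost_eq [Finite V] [Finite A] (D : Network V A) (v w : V)
    (h : ∃ P, D.IsPath v w P) :
    (∃ P, D.IsPath v w P ∧ D.listCost P = D.pathCost v w) ∧
      ∀ P, D.IsPath v w P → D.pathCost v w ≤ D.listCost P := by
  have hfin : {z | ∃ P, D.IsPath v w P ∧ D.listCost P = z}.Finite :=
    (D.finite_isPath v w).image D.listCost
  obtain ⟨P, hP⟩ := h
  have hne : {z | ∃ P, D.IsPath v w P ∧ D.listCost P = z}.Nonempty := ⟨_, P, hP, rfl⟩
  exact ⟨hne.csInf_mem hfin, fun Q hQ => csInf_le hfin.bddBelow ⟨Q, hQ, rfl⟩⟩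

section FlowOverTime

variable [Fintype A]

open scoped Classical in
/-- The excess of node `v` at time `r`: the total flow that has arrived at `v` minus the total flow
that has left `v` until time `r`. Here `f a r` is the rate at which flow enters arc `a` at its tail
at time `r`. -/
noncomputable def excess (D : Network V A) (f : A → ℝ → ℝ) (v : V) (r : ℝ) : ℝ :=
  (∑ a with D.head a = v, ∫ x in Set.Ico 0 (r - D.transit a), f a x) -
    ∑ a with D.tail a = v, ∫ x in Set.Ico 0 r, f a x

/-- `f` is a flow over time with time horizon `θ`, sources `Sp` and sinks `Sm`. The inflow rate
`f a` of arc `a` is a Lebesgue-measurable function on `[0, θ - τ_a)`, extended by zero to the real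
line. If `storage = false`, then flow may not be stored at intermediate nodes, not even
temporarily. -/
structure IsFlowOverTime (D : Network V A) (storage : Bool) (Sp Sm : Finset V) (θ : ℝ)
    (f : A → ℝ → ℝ) : Prop where
  horizon_nonneg : 0 ≤ θ
  measurable : ∀ a, AEMeasurable (f a) MeasureTheory.volume
  eq_zero : ∀ a, ∀ x, x ∉ Set.Ico 0 (θ - D.transit a) → f a x = 0
  nonneg : ∀ a x, 0 ≤ f a x
  le_capacity : ∀ a x, f a x ≤ D.capacity a
  no_deficit : ∀ v, v ∉ Sp → ∀ r ∈ Set.Icc 0 θ, 0 ≤ D.excess f v r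
  no_surplus : ∀ v, v ∉ Sp → v ∉ Sm → D.excess f v θ = 0
  no_storage : storage = false →
    ∀ v, v ∉ Sp → v ∉ Sm → ∀ r ∈ Set.Icc 0 θ, D.excess f v r = 0

/-- The cost of a flow over time with time horizon `θ`. -/
noncomputable def flowCost (D : Network V A) (θ : ℝ) (f : A → ℝ → ℝ) : ℝ :=
  ∑ a, D.cost a * ∫ x in Set.Ico 0 (θ - D.transit a), f a x

end FlowOverTime

end Network

/-- An instance of the minimum cost transshipment over time problem: a network with conservative
costs, sources with positive supplies `b s` and sinks with positive demands `-b t`, the total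
supply being equal to the total demand. The values of `b` at other nodes play no role. -/
structure Problem (V A : Type*) extends Network V A where
  conservative : toNetwork.Conservative
  sources : Finset V
  sinks : Finset V
  disjoint : Disjoint sources sinks
  b : V → ℝ
  supply_pos : ∀ s ∈ sources, 0 < b s
  demand_pos : ∀ t ∈ sinks, 0 < -b t
  balanced : ∑ s ∈ sources, b s + ∑ t ∈ sinks, b t = 0

namespace Problem

variable {V A : Type*}

section Transshipment

variable [Fintype A]

/-- `f` is a transshipment over time with time horizon `θ`: at time `θ` every source has sent its
supply and every sink has received its demand. -/
structure IsTransshipment (D : Problem V A) (storage : Bool) (θ : ℝ) (f : A → ℝ → ℝ) : Prop where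
  isFlow : D.IsFlowOverTime storage D.sources D.sinks θ f
  source : ∀ s ∈ D.sources, D.excess f s θ = -D.b s
  sink : ∀ t ∈ D.sinks, D.excess f t θ = -D.b t

/-- The set of costs of all transshipments over time, with arbitrary time horizons. -/
def transshipmentCosts (D : Problem V A) (storage : Bool) : Set ℝ :=
  {z | ∃ θ f, D.IsTransshipment storage θ f ∧ D.flowCost θ f = z}

/-- A transshipment over time of minimum cost among all transshipments over time, whatever their
time horizons. -/
def IsMinCostTransshipment (D : Problem V A) (storage : Bool) (θ : ℝ) (f : A → ℝ → ℝ) : Prop :=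
  D.IsTransshipment storage θ f ∧
    ∀ θ' f', D.IsTransshipment storage θ' f' → D.flowCost θ f ≤ D.flowCost θ' f'

/-- The flow over time `f` sends a positive amount of flow from `s` to `t`: `f` is the sum of
flows over time `g s' t'`, one for each source `s'` and sink `t'`, where `g s' t'` has the only
source `s'` and the only sink `t'`, and the amount of flow which `g s t` delivers at `t` is
positive. (If `f` does not store flow at a node that is neither a source nor a sink, then neither
do the summands, as their excesses at such a node are non-negative and add up to that of `f`.) -/
def SendsPositive (D : Problem V A) (θ : ℝ) (f : A → ℝ → ℝ) (s t : V) : Prop :=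
  ∃ g : V → V → A → ℝ → ℝ,
    (∀ s' ∈ D.sources, ∀ t' ∈ D.sinks, D.IsFlowOverTime true {s'} {t'} θ (g s' t')) ∧
    (∀ a x, f a x = ∑ s' ∈ D.sources, ∑ t' ∈ D.sinks, g s' t' a x) ∧
    0 < D.excess (g s t) t θ

end Transshipment

section Transportation

/-- The arc set of the bipartite network: all pairs `(s, t)` of a source `s` and a sink `t` such
that the network has an `s`-`t`-path. -/
def bipartiteArcs (D : Problem V A) : Set (V × V) :=
  {p | p.1 ∈ D.sources ∧ p.2 ∈ D.sinks ∧ ∃ P, D.IsPath p.1 p.2 P}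

open scoped Classical in
/-- `x` is a feasible solution to the static transportation problem on the bipartite network with
infinite capacities; only the values `x s t` with `(s, t) ∈ D.bipartiteArcs` matter. -/
structure IsTransportation (D : Problem V A) (x : V → V → ℝ) : Prop where
  nonneg : ∀ s t, (s, t) ∈ D.bipartiteArcs → 0 ≤ x s t
  source : ∀ s ∈ D.sources, ∑ t ∈ D.sinks with (s, t) ∈ D.bipartiteArcs, x s t = D.b s
  sink : ∀ t ∈ D.sinks, ∑ s ∈ D.sources with (s, t) ∈ D.bipartiteArcs, -x s t = D.b t

open scoped Classical in
/-- The cost of `x`, where the cost of arc `(s, t)` is the cost of a cheapest `s`-`t`-path. -/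
noncomputable def transportationCost (D : Problem V A) (x : V → V → ℝ) : ℝ :=
  ∑ p ∈ D.sources ×ˢ D.sinks with p ∈ D.bipartiteArcs, D.pathCost p.1 p.2 * x p.1 p.2

/-- The set of costs of all feasible solutions to the transportation problem. -/
def transportationCosts (D : Problem V A) : Set ℝ :=
  {z | ∃ x, D.IsTransportation x ∧ D.transportationCost x = z}

/-- An optimal solution to the transportation problem. -/
def IsOptimalTransportation (D : Problem V A) (x : V → V → ℝ) : Prop :=
  D.IsTransportation x ∧
    ∀ x', D.IsTransportation x' → D.transportationCost x ≤ D.transportationCost x'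

end Transportation

end Problem

end TransOverTime

namespace TransOverTime

namespace Network

variable {V A : Type*}

/-! ### Walks, paths and potentials under conservative costs. -/

section Walks

variable (D : Network V A)

theorem IsWalk.of_append {v w : V} {P Q : List A} (h : D.IsWalk v w (P ++ Q)) :
    ∃ z, D.IsWalk v z P ∧ D.IsWalk z w Q := by
  induction P generalizing v with
  | nil => exact ⟨v, rfl, h⟩
  | cons a P ih =>
    obtain ⟨z, h1, h2⟩ := ih h.2
    exact ⟨z, ⟨h.1, h1⟩, h2⟩

theorem IsWalk.append {v z w : V} {P Q : List A} (hP : D.IsWalk v z P) (hQ : D.IsWalk z w Q) :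
    D.IsWalk v w (P ++ Q) := by
  induction P generalizing v with
  | nil => obtain rfl : v = z := hP; exact hQ
  | cons a P ih => exact ⟨hP.1, ih hP.2⟩

theorem IsWalk.eq_of_append_singleton {v w : V} {P : List A} {a : A}
    (h : D.IsWalk v w (P ++ [a])) : D.head a = w := by
  obtain ⟨z, -, h2⟩ := IsWalk.of_append D h
  exact h2.2

theorem IsWalk.end_unique {v w z : V} {P : List A} (hw : D.IsWalk v w P) (hz : D.IsWalk v z P) :
    w = z := by
  induction P generalizing v with
  | nil => exact hw.symm.trans hz
  | cons a P ih => exact ih hw.2 hz.2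

/-- A walk contains a path between the same nodes; if the costs are conservative, then the path is
not more expensive than the walk. -/
theorem IsWalk.exists_isPath (hD : D.Conservative) {v w : V} {P : List A} (h : D.IsWalk v w P) :
    ∃ Q, D.IsPath v w Q ∧ Q ⊆ P ∧ D.listCost Q ≤ D.listCost P := by
  induction P generalizing v with
  | nil => exact ⟨[], ⟨h, by simp⟩, List.Subset.refl _, le_rfl⟩
  | cons a P ih =>
    obtain ⟨Q, hQ, hsub, hcost⟩ := ih h.2
    have hcons : ∀ R : List A, D.listCost (a :: R) = D.cost a + D.listCost R := by
      intro R; simp [listCost]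
    by_cases hv : v ∈ D.head a :: Q.map D.head
    -- The path `Q` returns to `v`: cut it there, so that `a :: Q₁` is a cycle, of non-negative
    -- cost, and `Q₂` remains.
    · obtain ⟨Q₁, Q₂, rfl, hw₁⟩ : ∃ Q₁ Q₂, Q = Q₁ ++ Q₂ ∧ D.IsWalk (D.head a) v Q₁ := by
        rcases List.mem_cons.1 hv with h0 | h0
        · exact ⟨[], Q, rfl, h0.symm⟩
        · obtain ⟨e, he, rfl⟩ := List.mem_map.1 h0
          obtain ⟨l₁, l₂, rfl⟩ := List.append_of_mem he
          have h1 : D.IsWalk (D.head a) w ((l₁ ++ [e]) ++ l₂) := by simpa using hQ.1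
          obtain ⟨z, hz, -⟩ := IsWalk.of_append D h1
          obtain rfl := IsWalk.eq_of_append_singleton D hz
          exact ⟨l₁ ++ [e], l₂, by simp, hz⟩
      have hnd := hQ.2
      rw [List.map_append, ← List.cons_append] at hnd
      obtain ⟨z, hz₁, hz₂⟩ := IsWalk.of_append D hQ.1
      obtain rfl := IsWalk.end_unique D hw₁ hz₁
      have hcycle : D.IsCycle (a :: Q₁) :=
        ⟨by simp, ⟨v, h.1, hw₁⟩, by simpa using hnd.of_append_left⟩
      have hmem : v ∈ D.head a :: Q₁.map D.head := by
        rcases List.eq_nil_or_concat Q₁ with rfl | ⟨l, e, rfl⟩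
        · simpa using hw₁.symm
        · rw [List.concat_eq_append] at hw₁
          have := IsWalk.eq_of_append_singleton D hw₁
          simp [this]
      refine ⟨Q₂, ⟨hz₂, List.nodup_cons.2 ⟨?_, hnd.of_append_right⟩⟩, ?_, ?_⟩
      · intro hm
        exact List.disjoint_of_nodup_append hnd hmem hm
      · intro e he
        exact List.mem_cons_of_mem _ (hsub (List.mem_append_right _ he))
      · have h0 := hD _ hcycle
        have h1 : D.listCost (Q₁ ++ Q₂) = D.listCost Q₁ + D.listCost Q₂ := by simp [listCost]
        rw [hcons] at h0 ⊢
        linarith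
    · refine ⟨a :: Q, ⟨⟨h.1, hQ.1⟩, ?_⟩, ?_, ?_⟩
      · rw [List.map_cons]
        exact List.nodup_cons.2 ⟨hv, hQ.2⟩
      · exact List.cons_subset_cons a hsub
      · rw [hcons, hcons]; linarith

/-- Conservative costs admit a feasible potential. -/
theorem Conservative.exists_potential [Finite V] [Finite A] (hD : D.Conservative) :
    ∃ φ : V → ℝ, ∀ a, φ (D.head a) ≤ φ (D.tail a) + D.cost a := by
  -- The potential of `v` is the least cost of a path ending at `v`, over all starting nodes. The
  -- empty path makes this a minimum over a nonempty set.
  have key : ∀ v, ∃ u, (∃ P, D.IsPath u v P) ∧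
      ∀ u', (∃ P, D.IsPath u' v P) → D.pathCost u v ≤ D.pathCost u' v := by
    intro v
    obtain ⟨u, hu, hmin⟩ := Set.exists_min_image {u | ∃ P, D.IsPath u v P}
      (fun u => D.pathCost u v) (Set.toFinite _) ⟨v, [], rfl, by simp⟩
    exact ⟨u, hu, hmin⟩
  choose u hu hmin using key
  refine ⟨fun v => D.pathCost (u v) v, fun a => ?_⟩
  obtain ⟨⟨P, hP, hPc⟩, -⟩ := D.exists_isPath_listCost_eq _ _ (hu (D.tail a))
  have hwalk : D.IsWalk (u (D.tail a)) (D.head a) (P ++ [a]) :=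
    IsWalk.append D hP.1 ⟨rfl, rfl⟩
  obtain ⟨Q, hQ, -, hQc⟩ := IsWalk.exists_isPath D hD hwalk
  have h1 := hmin (D.head a) _ ⟨Q, hQ⟩
  have h2 := (D.exists_isPath_listCost_eq _ _ ⟨Q, hQ⟩).2 Q hQ
  have h3 : D.listCost (P ++ [a]) = D.listCost P + D.cost a := by simp [listCost]
  show D.pathCost _ _ ≤ D.pathCost _ _ + _
  linarith

end Walks

/-! ### Decomposition of static flows into path flows. -/

section StaticFlow

variable [Fintype A]

open scoped Classical in
/-- The net inflow of the static flow `y` into node `v`. -/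
noncomputable def netInflow (D : Network V A) (y : A → ℝ) (v : V) : ℝ :=
  (∑ a with D.head a = v, y a) - ∑ a with D.tail a = v, y a

variable (D : Network V A)

theorem netInflow_sub_mul (y p : A → ℝ) (ε : ℝ) (v : V) :
    D.netInflow (fun a => y a - ε * p a) v = D.netInflow y v - ε * D.netInflow p v := by
  simp only [netInflow, Finset.sum_sub_distrib, ← Finset.mul_sum]
  ring

/-- Summation by parts. It is used with constant potentials (conservation), with indicators (cuts)
and with a feasible potential (cost of a circulation). -/
theorem sum_mul_netInflow [Fintype V] (φ : V → ℝ) (y : A → ℝ) :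
    ∑ v, φ v * D.netInflow y v = ∑ a, (φ (D.head a) - φ (D.tail a)) * y a := by
  classical
  have key : ∀ e : A → V, ∑ v, φ v * ∑ a with e a = v, y a = ∑ a, φ (e a) * y a := by
    intro e
    rw [← Finset.sum_fiberwise (g := e)]
    refine Finset.sum_congr rfl fun v _ => ?_
    rw [Finset.mul_sum]
    refine Finset.sum_congr rfl fun a ha => ?_
    rw [(Finset.mem_filter.1 ha).2]
  have h1 := key D.head
  have h2 := key D.tail
  simp only [netInflow, mul_sub, Finset.sum_sub_distrib, sub_mul]
  rw [← h1, ← h2]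

theorem sum_netInflow [Fintype V] (y : A → ℝ) : ∑ v, D.netInflow y v = 0 := by
  simpa using D.sum_mul_netInflow (fun _ => 1) y

open scoped Classical in
theorem IsWalk.netInflow_count {v w : V} {P : List A} (h : D.IsWalk v w P) (z : V) :
    D.netInflow (fun a => (P.count a : ℝ)) z =
      (if z = w then 1 else 0) - (if z = v then 1 else 0) := by
  induction P generalizing v with
  | nil => obtain rfl : v = w := h; simp [netInflow]
  | cons a P ih =>
    have h1 := ih h.2
    obtain rfl := h.1
    have hs : ∀ e : A → V, ∑ b with e b = z, ((a :: P).count b : ℝ) =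
        (∑ b with e b = z, (P.count b : ℝ)) + if z = e a then 1 else 0 := by
      intro e
      simp only [List.count_cons, Nat.cast_add, Finset.sum_add_distrib]
      congr 1
      simp [eq_comm (a := z)]
    rw [netInflow, hs, hs]
    rw [netInflow] at h1
    linarith

theorem cost_count (P : List A) [DecidableEq A] :
    ∑ a, D.cost a * (P.count a : ℝ) = D.listCost P := by
  induction P with
  | nil => simp [listCost]
  | cons b P ih =>
    have : D.listCost (b :: P) = D.cost b + D.listCost P := by simp [listCost]
    rw [this, ← ih]
    simp [List.count_cons, mul_add, Finset.sum_add_distrib, add_comm]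

/-- From a node with negative net inflow, a node with positive net inflow can be reached along arcs
that carry flow. -/
theorem exists_isPath_of_netInflow_neg [Fintype V] (hD : D.Conservative) {y : A → ℝ}
    (hy : ∀ a, 0 ≤ y a) {v : V} (hv : D.netInflow y v < 0) :
    ∃ w P, 0 < D.netInflow y w ∧ D.IsPath v w P ∧ ∀ a ∈ P, 0 < y a := by
  classical
  by_contra! hcon
  -- Cut argument: no arc with flow leaves the set `R` of nodes reachable from `v`, so its total net
  -- inflow is non-negative. But no node of `R` has positive net inflow, and that of `v` is
  -- negative.
  let R : V → Prop := fun z => ∃ P, D.IsWalk v z P ∧ ∀ a ∈ P, 0 < y a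
  have hR : ∀ z, R z → D.netInflow y z ≤ 0 := by
    rintro z ⟨P, hP, hpos⟩
    by_contra! hz
    obtain ⟨Q, hQ, hsub, -⟩ := IsWalk.exists_isPath D hD hP
    obtain ⟨a, ha, ha'⟩ := hcon z Q hz hQ
    exact absurd (hpos a (hsub ha)) (not_lt.2 ha')
  have hRv : R v := ⟨[], rfl, by simp⟩
  have h1 := D.sum_mul_netInflow (fun z => if R z then 1 else 0) y
  have h2 : 0 ≤ ∑ a, ((if R (D.head a) then (1 : ℝ) else 0) - (if R (D.tail a) then 1 else 0)) *
      y a := by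
    refine Finset.sum_nonneg fun a _ => ?_
    rcases (hy a).eq_or_lt with h0 | h0
    · simp [← h0]
    · have : R (D.tail a) → R (D.head a) := by
        rintro ⟨P, hP, hpos⟩
        refine ⟨P ++ [a], IsWalk.append D hP ⟨rfl, rfl⟩, ?_⟩
        intro e he
        rcases List.mem_append.1 he with he | he
        · exact hpos e he
        · rw [List.mem_singleton.1 he]; exact h0
      refine mul_nonneg ?_ h0.le
      by_cases ht : R (D.tail a)
      · simp [ht, this ht]
      · simp only [ht, if_false, sub_zero]; split_ifs <;> norm_num
  have h3 : ∑ z, (if R z then (1 : ℝ) else 0) * D.netInflow y z < 0 := by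
    refine Finset.sum_neg' (fun z _ => ?_) ⟨v, Finset.mem_univ _, ?_⟩
    · by_cases hz : R z
      · simpa [hz] using hR z hz
      · simp [hz]
    · simpa [hRv] using hv
  linarith

/-- A static flow decomposes into flows along paths, from nodes with negative to nodes with positive
net inflow, whose total cost does not exceed that of the given flow. -/
theorem exists_path_decomposition [Fintype V] (hD : D.Conservative) (y : A → ℝ)
    (hy : ∀ a, 0 ≤ y a) :
    ∃ x : V → V → ℝ, (∀ v w, 0 ≤ x v w) ∧ (∀ v w, x v w ≠ 0 → ∃ P, D.IsPath v w P) ∧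
      (∀ v, ∑ w, x v w = max (-D.netInflow y v) 0) ∧
      (∀ w, ∑ v, x v w = max (D.netInflow y w) 0) ∧
      ∑ v, ∑ w, D.pathCost v w * x v w ≤ ∑ a, D.cost a * y a := by
  classical
  -- Each augmentation empties an arc or balances a node and creates no new flow-carrying arc or
  -- unbalanced node, so this count drops.
  induction hn : (Finset.univ.filter fun a => y a ≠ 0).card +
    (Finset.univ.filter fun v => D.netInflow y v ≠ 0).card using Nat.strong_induction_on
    generalizing y with
  | _ n ih =>
  by_cases hneg : ∃ v, D.netInflow y v < 0
  · obtain ⟨v, hv⟩ := hneg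
    obtain ⟨w, P, hw, hP, hpos⟩ := D.exists_isPath_of_netInflow_neg hD hy hv
    have hvw : v ≠ w := by rintro rfl; linarith
    have hPne : P ≠ [] := by rintro rfl; exact hvw hP.1
    obtain ⟨e, he, hemin⟩ := P.toFinset.exists_min_image y
      ((List.toFinset_nonempty_iff _).2 hPne)
    have hnd : P.Nodup := (List.nodup_cons.1 hP.2).2.of_map _
    -- The largest amount that keeps `y'` non-negative along `P` and does not flip the sign of
    -- either end's net inflow.
    set ε := min (y e) (min (-D.netInflow y v) (D.netInflow y w)) with hε
    have hεpos : 0 < ε := lt_min (hpos e (List.mem_toFinset.1 he)) (lt_min (by linarith) hw)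
    set p : A → ℝ := fun a => (P.count a : ℝ) with hp
    have hp1 : ∀ a ∈ P, p a = 1 := fun a ha => by
      simp [hp, List.count_eq_one_of_mem hnd ha]
    have hp0 : ∀ a, a ∉ P → p a = 0 := fun a ha => by
      simp [hp, List.count_eq_zero_of_not_mem ha]
    set y' : A → ℝ := fun a => y a - ε * p a with hy'
    have hεe : ε ≤ y e := min_le_left _ _
    have hεv : ε ≤ -D.netInflow y v := (min_le_right _ _).trans (min_le_left _ _)
    have hεw : ε ≤ D.netInflow y w := (min_le_right _ _).trans (min_le_right _ _)
    have hy'0 : ∀ a, 0 ≤ y' a := by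
      intro a
      by_cases ha : a ∈ P
      · have := hemin a (List.mem_toFinset.2 ha)
        simp only [hy', hp1 a ha]; linarith
      · simp only [hy', hp0 a ha]; linarith [hy a]
    have hnet : ∀ z, D.netInflow y' z =
        D.netInflow y z - ε * ((if z = w then 1 else 0) - (if z = v then 1 else 0)) := by
      intro z
      rw [hy', netInflow_sub_mul, hp, IsWalk.netInflow_count D hP.1]
    have hnetv : D.netInflow y' v = D.netInflow y v + ε := by rw [hnet]; simp [hvw]
    have hnetw : D.netInflow y' w = D.netInflow y w - ε := by rw [hnet]; simp [hvw.symm]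
    have hnetz : ∀ z, z ≠ v → z ≠ w → D.netInflow y' z = D.netInflow y z := by
      intro z h1 h2; rw [hnet]; simp [h1, h2]
    have hsub1 : (Finset.univ.filter fun a => y' a ≠ 0) ⊆
        Finset.univ.filter fun a => y a ≠ 0 := by
      intro a ha
      simp only [Finset.mem_filter, Finset.mem_univ, true_and] at ha ⊢
      by_cases hP' : a ∈ P
      · exact (hpos a hP').ne'
      · simpa [hy', hp0 a hP'] using ha
    have hsub2 : (Finset.univ.filter fun z => D.netInflow y' z ≠ 0) ⊆
        Finset.univ.filter fun z => D.netInflow y z ≠ 0 := by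
      intro z hz
      simp only [Finset.mem_filter, Finset.mem_univ, true_and] at hz ⊢
      by_cases h1 : z = v
      · rw [h1]; exact hv.ne
      by_cases h2 : z = w
      · rw [h2]; exact hw.ne'
      rwa [← hnetz z h1 h2]
    have hlt : (Finset.univ.filter fun a => y' a ≠ 0).card +
        (Finset.univ.filter fun z => D.netInflow y' z ≠ 0).card < n := by
      rw [← hn]
      have hor : y' e = 0 ∨ D.netInflow y' v = 0 ∨ D.netInflow y' w = 0 := by
        have h1 : ε = y e ∨ ε = -D.netInflow y v ∨ ε = D.netInflow y w := by
          rcases min_choice (y e) (min (-D.netInflow y v) (D.netInflow y w)) with h | h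
          · exact Or.inl h
          · rcases min_choice (-D.netInflow y v) (D.netInflow y w) with h' | h'
            · exact Or.inr (Or.inl (h.trans h'))
            · exact Or.inr (Or.inr (h.trans h'))
        rcases h1 with h | h | h
        · left; simp only [hy', hp1 e (List.mem_toFinset.1 he)]; linarith
        · right; left; rw [hnetv]; linarith
        · right; right; rw [hnetw]; linarith
      rcases hor with h | h | h
      · refine add_lt_add_of_lt_of_le (Finset.card_lt_card
          ((Finset.ssubset_iff_of_subset hsub1).2 ⟨e, ?_, ?_⟩)) (Finset.card_le_card hsub2)
        · simpa using (hpos e (List.mem_toFinset.1 he)).ne'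
        · simpa using h
      · refine add_lt_add_of_le_of_lt (Finset.card_le_card hsub1) (Finset.card_lt_card
          ((Finset.ssubset_iff_of_subset hsub2).2 ⟨v, ?_, ?_⟩))
        · simpa using hv.ne
        · simpa using h
      · refine add_lt_add_of_le_of_lt (Finset.card_le_card hsub1) (Finset.card_lt_card
          ((Finset.ssubset_iff_of_subset hsub2).2 ⟨w, ?_, ?_⟩))
        · simpa using hw.ne'
        · simpa using h
    obtain ⟨x, hx0, hxP, hxs, hxt, hxc⟩ := ih _ hlt y' hy'0 rfl
    refine ⟨fun i j => x i j + if i = v then (if j = w then ε else 0) else 0, ?_, ?_, ?_, ?_, ?_⟩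
    · intro i j
      have := hx0 i j
      dsimp only
      split_ifs <;> linarith
    · intro i j hij
      by_cases h0 : x i j = 0
      · dsimp only at hij
        by_cases h1 : i = v
        · by_cases h2 : j = w
          · subst h1 h2; exact ⟨P, hP⟩
          · simp [h0, h2] at hij
        · simp [h0, h1] at hij
      · exact hxP i j h0
    · intro i
      rw [Finset.sum_add_distrib, hxs]
      by_cases h1 : i = v
      · subst h1
        rw [hnetv, max_eq_left (by linarith), max_eq_left (by linarith)]
        simp
      · by_cases h2 : i = w
        · subst h2
          rw [hnetw, max_eq_right (by linarith), max_eq_right (by linarith)]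
          simp [h1]
        · rw [hnetz i h1 h2]; simp [h1]
    · intro j
      rw [Finset.sum_add_distrib, hxt]
      by_cases h1 : j = w
      · subst h1
        rw [hnetw, max_eq_left (by linarith), max_eq_left (by linarith)]
        simp
      · by_cases h2 : j = v
        · subst h2
          rw [hnetv, max_eq_right (by linarith), max_eq_right (by linarith)]
          simp [h1]
        · rw [hnetz j h2 h1]; simp [h1]
    · have h1 : ∑ a, D.cost a * y a = ∑ a, D.cost a * y' a + ε * D.listCost P := by
        rw [← cost_count, Finset.mul_sum, ← Finset.sum_add_distrib]
        refine Finset.sum_congr rfl fun a _ => ?_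
        simp only [hy', hp]; ring
      have h2 : ∑ i, ∑ j, D.pathCost i j *
          (x i j + if i = v then (if j = w then ε else 0) else 0) =
          ∑ i, ∑ j, D.pathCost i j * x i j + D.pathCost v w * ε := by
        simp only [mul_add, Finset.sum_add_distrib]
        congr 1
        rw [Finset.sum_eq_single v (by intro b _ hb; simp [hb]) (by simp)]
        simp
      have h3 := (D.exists_isPath_listCost_eq v w ⟨P, hP⟩).2 P hP
      rw [h1, h2]
      nlinarith
  · push Not at hneg
    have hzero : ∀ v, D.netInflow y v = 0 := fun v =>
      (Finset.sum_eq_zero_iff_of_nonneg fun v _ => hneg v).1 (D.sum_netInflow y) v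
        (Finset.mem_univ v)
    refine ⟨fun _ _ => 0, by simp, by simp, by simp [hzero], by simp [hzero], ?_⟩
    -- What is left is a circulation: its potential differences sum to zero and bound its cost from
    -- below.
    obtain ⟨φ, hφ⟩ := Conservative.exists_potential D hD
    have h1 := D.sum_mul_netInflow φ y
    simp only [hzero, mul_zero, Finset.sum_const_zero] at h1 ⊢
    rw [h1]
    exact Finset.sum_le_sum fun a _ =>
      mul_le_mul_of_nonneg_right (by linarith [hφ a]) (hy a)

end StaticFlow

end Network

end TransOverTime

namespace TransOverTime

namespace Network

variable {V A : Type*}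

/-! ### Flows over time as static flows. -/

section FlowsAsStaticFlows

open MeasureTheory

variable [Fintype A] (D : Network V A)

theorem excess_sum {ι : Type*} (I : Finset ι) {g : ι → A → ℝ → ℝ}
    (hg : ∀ i ∈ I, ∀ a, Integrable (g i a)) (v : V) (r : ℝ) :
    D.excess (fun a x => ∑ i ∈ I, g i a x) v r = ∑ i ∈ I, D.excess (g i) v r := by
  have key : ∀ a (s : Set ℝ), ∫ x in s, ∑ i ∈ I, g i a x = ∑ i ∈ I, ∫ x in s, g i a x :=
    fun a s => integral_finsetSum _ fun i hi => (hg i hi a).integrableOn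
  simp only [excess, key, Finset.sum_sub_distrib]
  congr 1 <;> exact Finset.sum_comm

variable {D}

theorem IsFlowOverTime.integrable {storage : Bool} {Sp Sm : Finset V} {θ : ℝ} {f : A → ℝ → ℝ}
    (hf : D.IsFlowOverTime storage Sp Sm θ f) (a : A) : Integrable (f a) := by
  have h1 : IntegrableOn (f a) (Set.Ico 0 (θ - D.transit a)) :=
    Measure.integrableOn_of_bounded (M := D.capacity a) (by simp)
      (hf.measurable a).aestronglyMeasurable
      (Filter.Eventually.of_forall fun x => by
        rw [Real.norm_of_nonneg (hf.nonneg a x)]; exact hf.le_capacity a x)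
  refine (integrableOn_iff_integrable_of_support_subset fun x hx => ?_).1 h1
  by_contra hx'
  exact hx (hf.eq_zero a x hx')

theorem IsFlowOverTime.setIntegral_eq {storage : Bool} {Sp Sm : Finset V} {θ : ℝ}
    {f : A → ℝ → ℝ} (hf : D.IsFlowOverTime storage Sp Sm θ f) (a : A) {r : ℝ}
    (hr : θ - D.transit a ≤ r) : ∫ x in Set.Ico 0 r, f a x = ∫ x, f a x :=
  setIntegral_eq_integral_of_forall_compl_eq_zero fun x hx =>
    hf.eq_zero a x fun h => hx ⟨h.1, h.2.trans_le hr⟩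

/-- Inflow into arc `a` stops by time `θ - τ_a`, so whatever has entered an arc has left it by time
`θ`. -/
theorem IsFlowOverTime.excess_horizon {storage : Bool} {Sp Sm : Finset V} {θ : ℝ}
    {f : A → ℝ → ℝ} (hf : D.IsFlowOverTime storage Sp Sm θ f) (v : V) :
    D.excess f v θ = D.netInflow (fun a => ∫ x, f a x) v := by
  have h1 : ∀ a, ∫ x in Set.Ico 0 (θ - D.transit a), f a x = ∫ x, f a x :=
    fun a => hf.setIntegral_eq a le_rfl
  have h2 : ∀ a, ∫ x in Set.Ico 0 θ, f a x = ∫ x, f a x :=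
    fun a => hf.setIntegral_eq a (by linarith [D.transit_nonneg a])
  simp only [excess, netInflow, h1, h2]

theorem IsFlowOverTime.flowCost_eq {storage : Bool} {Sp Sm : Finset V} {θ : ℝ}
    {f : A → ℝ → ℝ} (hf : D.IsFlowOverTime storage Sp Sm θ f) :
    D.flowCost θ f = ∑ a, D.cost a * ∫ x, f a x := by
  have h1 : ∀ a, ∫ x in Set.Ico 0 (θ - D.transit a), f a x = ∫ x, f a x :=
    fun a => hf.setIntegral_eq a le_rfl
  simp only [flowCost, h1]

end FlowsAsStaticFlows

/-! ### Constant-rate flows along a path. -/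

section PathFlow

open MeasureTheory

/-- The total transit time of a list of arcs. -/
def listTransit (D : Network V A) (P : List A) : ℝ := (P.map D.transit).sum

open scoped Classical in
/-- The flow over time that sends flow at rate `ρ` along `P` during a period of length `T`
starting at time `t`. -/
noncomputable def pathFlow (D : Network V A) (ρ T : ℝ) : ℝ → List A → A → ℝ → ℝ
  | _, [], _, _ => 0
  | t, a :: P, b, x => (if b = a then (Set.Ico t (t + T)).indicator (fun _ => ρ) x else 0) +
      pathFlow D ρ T (t + D.transit a) P b x

/-- The amount of flow sent until time `r`, if flow is sent at rate `ρ` during a period of length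
`T` starting at time `t`. -/
noncomputable def amountUntil (ρ T t r : ℝ) : ℝ := ρ * max (min r (t + T) - t) 0

theorem amountUntil_nonneg {ρ : ℝ} (hρ : 0 ≤ ρ) (T t r : ℝ) : 0 ≤ amountUntil ρ T t r :=
  mul_nonneg hρ (le_max_right _ _)

theorem amountUntil_of_le {ρ T t r : ℝ} (hT : 0 ≤ T) (h : t + T ≤ r) :
    amountUntil ρ T t r = ρ * T := by
  rw [amountUntil, min_eq_right h, add_sub_cancel_left, max_eq_left hT]

/-- What enters an arc from time `t` on arrives at its head as the same profile delayed by `τ`; this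
drives the telescoping in `excess_pathFlow`. -/
theorem amountUntil_sub (ρ T t r τ : ℝ) :
    amountUntil ρ T t (r - τ) = amountUntil ρ T (t + τ) r := by
  have : min (r - τ) (t + T) - t = min r (t + τ + T) - (t + τ) := by
    rw [← min_sub_sub_right, ← min_sub_sub_right]
    congr 1 <;> ring
  rw [amountUntil, amountUntil, this]

theorem setIntegral_indicator_const {ρ T t : ℝ} (ht : 0 ≤ t) (r : ℝ) :
    ∫ x in Set.Ico 0 r, (Set.Ico t (t + T)).indicator (fun _ => ρ) x = amountUntil ρ T t r := by
  rw [setIntegral_indicator measurableSet_Ico, Set.Ico_inter_Ico, setIntegral_const, amountUntil,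
    max_eq_right ht, smul_eq_mul, mul_comm]
  simp [Measure.real, ENNReal.toReal_ofReal']

theorem integrable_indicator_const (ρ T t : ℝ) :
    Integrable ((Set.Ico t (t + T)).indicator fun _ => ρ) :=
  (integrable_indicator_iff measurableSet_Ico).2 (integrableOn_const (by simp))

theorem listTransit_cons (D : Network V A) (a : A) (P : List A) :
    D.listTransit (a :: P) = D.transit a + D.listTransit P := by
  simp [listTransit]

theorem listTransit_nonneg (D : Network V A) (P : List A) : 0 ≤ D.listTransit P :=
  List.sum_nonneg fun x hx => by
    obtain ⟨a, -, rfl⟩ := List.mem_map.1 hx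
    exact D.transit_nonneg a

variable (D : Network V A)

theorem pathFlow_nonneg {ρ : ℝ} (hρ : 0 ≤ ρ) (T t : ℝ) (P : List A) (b : A) (x : ℝ) :
    0 ≤ D.pathFlow ρ T t P b x := by
  induction P generalizing t with
  | nil => exact le_rfl
  | cons a P ih =>
    refine add_nonneg ?_ (ih _)
    split_ifs
    · exact Set.indicator_nonneg (fun _ _ => hρ) x
    · exact le_rfl

/-- A crude bound, one `ρ` per entry of `P`, which avoids tracking repeated arcs; it suffices
because the period `T` can be chosen freely. -/
theorem pathFlow_le {ρ : ℝ} (hρ : 0 ≤ ρ) (T t : ℝ) (P : List A) (b : A) (x : ℝ) :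
    D.pathFlow ρ T t P b x ≤ ρ * P.length := by
  classical
  induction P generalizing t with
  | nil => simp [pathFlow]
  | cons a P ih =>
    have h1 := ih (t + D.transit a)
    have h2 : (if b = a then (Set.Ico t (t + T)).indicator (fun _ => ρ) x else 0) ≤ ρ := by
      split_ifs
      · exact Set.indicator_apply_le' (fun _ => le_rfl) fun _ => hρ
      · exact hρ
    rw [pathFlow, List.length_cons]
    push_cast
    linarith

theorem integrable_pathFlow (ρ T t : ℝ) (P : List A) (b : A) :
    Integrable (D.pathFlow ρ T t P b) := by
  induction P generalizing t with
  | nil => exact integrable_zero _ _ _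
  | cons a P ih =>
    refine Integrable.add ?_ (ih _)
    by_cases h : b = a
    · simpa only [h, if_true] using integrable_indicator_const ρ T t
    · simp [h]

theorem pathFlow_eq_zero {ρ T t θ : ℝ} (ht : 0 ≤ t) {P : List A}
    (hθ : t + D.listTransit P + T ≤ θ) {b : A} {x : ℝ}
    (hx : x ∉ Set.Ico 0 (θ - D.transit b)) : D.pathFlow ρ T t P b x = 0 := by
  induction P generalizing t with
  | nil => rfl
  | cons a P ih =>
    rw [listTransit_cons] at hθ
    rw [pathFlow, ih (add_nonneg ht (D.transit_nonneg a)) (by linarith), add_zero]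
    split_ifs with h
    · subst h
      refine Set.indicator_of_notMem (fun h' => hx ⟨ht.trans h'.1, ?_⟩) _
      have := h'.2
      linarith [D.listTransit_nonneg P]
    · rfl

variable [Fintype A]

-- Arrival on one arc cancels departure on the next at every moment, so only the two ends
-- contribute. This is what makes the path flow valid without storage.
open scoped Classical in
theorem excess_pathFlow {ρ T t : ℝ} (ht : 0 ≤ t) {P : List A} {v w : V} (hP : D.IsWalk v w P)
    (z : V) (r : ℝ) :
    D.excess (D.pathFlow ρ T t P) z r =
      (if z = w then amountUntil ρ T (t + D.listTransit P) r else 0) -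
        (if z = v then amountUntil ρ T t r else 0) := by
  induction P generalizing t v with
  | nil => obtain rfl : v = w := hP; simp [pathFlow, excess, listTransit]
  | cons a P ih =>
    have h1 := ih (t := t + D.transit a) (add_nonneg ht (D.transit_nonneg a)) hP.2
    obtain rfl := hP.1
    have hs : ∀ (e : A → V) (q : A → ℝ),
        ∑ b with e b = z, ∫ x in Set.Ico 0 (q b), D.pathFlow ρ T t (a :: P) b x =
          (if z = e a then amountUntil ρ T t (q a) else 0) +
          ∑ b with e b = z, ∫ x in Set.Ico 0 (q b), D.pathFlow ρ T (t + D.transit a) P b x := by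
      intro e q
      have h2 : ∀ b, ∫ x in Set.Ico 0 (q b), D.pathFlow ρ T t (a :: P) b x =
          (if b = a then amountUntil ρ T t (q a) else 0) +
          ∫ x in Set.Ico 0 (q b), D.pathFlow ρ T (t + D.transit a) P b x := by
        intro b
        simp only [pathFlow]
        by_cases h : b = a
        · subst h
          simp only [if_true]
          rw [integral_add (integrable_indicator_const ρ T t).integrableOn
            (D.integrable_pathFlow _ _ _ _ _).integrableOn, setIntegral_indicator_const ht]
        · simp [h]
      simp only [h2, Finset.sum_add_distrib]
      congr 1
      simp [eq_comm (a := z)]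
    rw [excess, hs, hs, amountUntil_sub, listTransit_cons, ← add_assoc]
    rw [excess] at h1
    linarith

theorem cost_pathFlow {ρ T : ℝ} (hT : 0 ≤ T) (t : ℝ) (P : List A) :
    ∑ a, D.cost a * ∫ x, D.pathFlow ρ T t P a x = D.listCost P * (ρ * T) := by
  classical
  induction P generalizing t with
  | nil => simp [pathFlow, listCost]
  | cons a P ih =>
    have h2 : ∀ b, ∫ x, D.pathFlow ρ T t (a :: P) b x =
        (if b = a then ρ * T else 0) + ∫ x, D.pathFlow ρ T (t + D.transit a) P b x := by
      intro b
      simp only [pathFlow]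
      by_cases h : b = a
      · subst h
        simp only [if_true]
        rw [integral_add (integrable_indicator_const ρ T t) (D.integrable_pathFlow _ _ _ _ _),
          integral_indicator measurableSet_Ico, setIntegral_const]
        simp [Measure.real, hT, mul_comm]
      · simp [h]
    simp only [h2, mul_add, Finset.sum_add_distrib, ih]
    simp [listCost, add_mul]

end PathFlow

end Network

end TransOverTime

namespace TransOverTime

namespace Problem

variable {V A : Type*}

/-! ### Existence of optimal transportation solutions. -/

section Transportation

variable (D : Problem V A)

open scoped Classical in
theorem transportationCost_eq (x : V → V → ℝ) :
    D.transportationCost x = ∑ s ∈ D.sources, ∑ t ∈ D.sinks,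
      if (s, t) ∈ D.bipartiteArcs then D.pathCost s t * x s t else 0 := by
  rw [transportationCost, Finset.sum_filter, Finset.sum_product]

open scoped Classical in
/-- The transportation problem has an optimal solution if it has a feasible one. -/
theorem exists_isOptimalTransportation [Fintype V] (h : ∃ x, D.IsTransportation x) :
    ∃ x, D.IsOptimalTransportation x := by
  -- Values off `D.bipartiteArcs` are unconstrained, so the feasible set itself need not be bounded.
  -- Zeroing them changes neither feasibility nor cost and yields a compact set `K`.
  let trunc : (V → V → ℝ) → V → V → ℝ := fun x s t => if (s, t) ∈ D.bipartiteArcs then x s t else 0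
  have htrunc : ∀ x s t, (s, t) ∈ D.bipartiteArcs → trunc x s t = x s t :=
    fun x s t hst => if_pos hst
  have hfeas : ∀ x, D.IsTransportation x → D.IsTransportation (trunc x) := by
    intro x hx
    refine ⟨fun s t hst => ?_, fun s hs => ?_, fun t ht => ?_⟩
    · rw [htrunc x s t hst]; exact hx.nonneg s t hst
    · rw [← hx.source s hs]
      exact Finset.sum_congr rfl fun t ht => htrunc x s t (Finset.mem_filter.1 ht).2
    · rw [← hx.sink t ht]
      exact Finset.sum_congr rfl fun s hs => by rw [htrunc x s t (Finset.mem_filter.1 hs).2]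
  have hcost : ∀ x, D.transportationCost (trunc x) = D.transportationCost x := by
    intro x
    refine Finset.sum_congr rfl fun p hp => ?_
    rw [htrunc x p.1 p.2 (Finset.mem_filter.1 hp).2]
  let K : Set (V → V → ℝ) := {x | D.IsTransportation x ∧ ∀ s t, (s, t) ∉ D.bipartiteArcs → x s t = 0}
  have hKtrunc : ∀ x, D.IsTransportation x → trunc x ∈ K :=
    fun x hx => ⟨hfeas x hx, fun s t hst => if_neg hst⟩
  have hev : ∀ s t : V, Continuous fun x : V → V → ℝ => x s t := fun s t => by fun_prop
  have hclosed : IsClosed K := by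
    have hK : K = (⋂ s, ⋂ t, {x | (s, t) ∈ D.bipartiteArcs → 0 ≤ x s t}) ∩
        (⋂ s, {x | s ∈ D.sources → ∑ t ∈ D.sinks with (s, t) ∈ D.bipartiteArcs, x s t = D.b s}) ∩
        (⋂ t, {x | t ∈ D.sinks →
          ∑ s ∈ D.sources with (s, t) ∈ D.bipartiteArcs, -x s t = D.b t}) ∩
        (⋂ s, ⋂ t, {x | (s, t) ∉ D.bipartiteArcs → x s t = 0}) := by
      ext x
      simp only [Set.mem_inter_iff, Set.mem_iInter, Set.mem_ofPred_eq, K]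
      exact ⟨fun h => ⟨⟨⟨h.1.nonneg, h.1.source⟩, h.1.sink⟩, h.2⟩,
        fun h => ⟨⟨h.1.1.1, h.1.1.2, h.1.2⟩, h.2⟩⟩
    have himp : ∀ (p : Prop) (q : (V → V → ℝ) → Prop), IsClosed {x | q x} →
        IsClosed {x | p → q x} := by
      intro p q hq
      by_cases hp : p
      · simpa [hp] using hq
      · simp [hp]
    rw [hK]
    refine ((IsClosed.inter ?_ ?_).inter ?_).inter ?_
    · exact isClosed_iInter fun s => isClosed_iInter fun t =>
        himp _ _ (isClosed_le continuous_const (hev s t))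
    · exact isClosed_iInter fun s => himp _ _ (isClosed_eq (by fun_prop) continuous_const)
    · exact isClosed_iInter fun t => himp _ _ (isClosed_eq (by fun_prop) continuous_const)
    · exact isClosed_iInter fun s => isClosed_iInter fun t =>
        himp _ _ (isClosed_eq (hev s t) continuous_const)
  -- An entry is at most its row sum `D.b s`; the maximum with 0 covers nodes that are not sources,
  -- where `D.b` may be negative.
  have hsub : K ⊆ Set.Icc (fun _ _ => 0) (fun s _ => max (D.b s) 0) := by
    rintro x ⟨hx, hx0⟩
    refine ⟨fun s t => ?_, fun s t => ?_⟩ <;> by_cases hst : (s, t) ∈ D.bipartiteArcs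
    · exact hx.nonneg s t hst
    · exact (hx0 s t hst).ge
    · refine le_max_of_le_left ?_
      rw [← hx.source s hst.1]
      exact Finset.single_le_sum (f := fun t => x s t)
        (fun t ht => hx.nonneg s t (Finset.mem_filter.1 ht).2)
        (Finset.mem_filter.2 ⟨hst.2.1, hst⟩)
    · exact (hx0 s t hst).le.trans (le_max_right _ _)
  have hcomp : IsCompact K := isCompact_Icc.of_isClosed_subset hclosed hsub
  have hcont : Continuous D.transportationCost := by
    unfold transportationCost
    fun_prop
  obtain ⟨x₀, hx₀⟩ := h
  obtain ⟨x, hxK, hmin⟩ := hcomp.exists_isMinOn ⟨_, hKtrunc x₀ hx₀⟩ hcont.continuousOn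
  refine ⟨x, hxK.1, fun x' hx' => ?_⟩
  rw [← hcost x']
  exact hmin (hKtrunc x' hx')

end Transportation

/-! ### From transshipments over time to transportation solutions. -/

section FromFlow

variable [Fintype V] [Fintype A] {D : Problem V A}

/-- A transshipment over time yields a solution of the transportation problem that is not more
expensive. -/
theorem IsTransshipment.exists_isTransportation {storage : Bool} {θ : ℝ} {f : A → ℝ → ℝ}
    (hf : D.IsTransshipment storage θ f) :
    ∃ x, D.IsTransportation x ∧ D.transportationCost x ≤ D.flowCost θ f := by
  classical
  have hnet := hf.isFlow.excess_horizon
  obtain ⟨x, hx0, hxP, hxs, hxt, hxc⟩ := D.exists_path_decomposition D.conservative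
    (fun a => ∫ y, f a y) fun a => MeasureTheory.integral_nonneg (hf.isFlow.nonneg a)
  rw [← hf.isFlow.flowCost_eq] at hxc
  simp only [← hnet] at hxs hxt
  have hrow : ∀ s t, x s t ≠ 0 → 0 < -D.excess f s θ := by
    intro s t h
    by_contra! h'
    have := hxs s
    rw [max_eq_right h'] at this
    exact h ((Finset.sum_eq_zero_iff_of_nonneg fun t _ => hx0 s t).1 this t (Finset.mem_univ t))
  have hcol : ∀ s t, x s t ≠ 0 → 0 < D.excess f t θ := by
    intro s t h
    by_contra! h'
    have := hxt t
    rw [max_eq_right h'] at this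
    exact h ((Finset.sum_eq_zero_iff_of_nonneg fun s _ => hx0 s t).1 this s (Finset.mem_univ s))
  -- Only sources can end with a deficit and only sinks with a surplus, so the decomposition is
  -- supported on `D.bipartiteArcs`.
  have hmem : ∀ s t, x s t ≠ 0 → (s, t) ∈ D.bipartiteArcs := by
    intro s t h
    refine ⟨?_, ?_, hxP s t h⟩
    · by_contra hs
      have h1 := hrow s t h
      have h2 := hf.isFlow.no_deficit s hs θ ⟨hf.isFlow.horizon_nonneg, le_rfl⟩
      linarith
    · by_contra ht
      have h1 := hcol s t h
      by_cases hs : t ∈ D.sources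
      · rw [hf.source t hs] at h1
        linarith [D.supply_pos t hs]
      · linarith [hf.isFlow.no_surplus t hs ht]
  have hsum_sinks : ∀ s, ∑ t ∈ D.sinks with (s, t) ∈ D.bipartiteArcs, x s t = ∑ t, x s t := by
    intro s
    refine Finset.sum_subset (Finset.subset_univ _) fun t _ ht => ?_
    by_contra h
    exact ht (Finset.mem_filter.2 ⟨(hmem s t h).2.1, hmem s t h⟩)
  have hsum_sources : ∀ t, ∑ s ∈ D.sources with (s, t) ∈ D.bipartiteArcs, x s t = ∑ s, x s t := by
    intro t
    refine Finset.sum_subset (Finset.subset_univ _) fun s _ hs => ?_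
    by_contra h
    exact hs (Finset.mem_filter.2 ⟨(hmem s t h).1, hmem s t h⟩)
  refine ⟨x, ⟨fun s t _ => hx0 s t, fun s hs => ?_, fun t ht => ?_⟩, ?_⟩
  · rw [hsum_sinks, hxs, hf.source s hs, neg_neg, max_eq_left (D.supply_pos s hs).le]
  · rw [Finset.sum_neg_distrib, hsum_sources, hxt, hf.sink t ht,
      max_eq_left (D.demand_pos t ht).le, neg_neg]
  · refine le_trans (le_of_eq ?_) hxc
    rw [transportationCost, ← Finset.sum_product' (f := fun s t => D.pathCost s t * x s t)]
    refine Finset.sum_subset (Finset.subset_univ _) fun p _ hp => ?_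
    by_contra h
    have h' := hmem p.1 p.2 (right_ne_zero_of_mul h)
    exact hp (Finset.mem_filter.2 ⟨Finset.mem_product.2 ⟨h'.1, h'.2.1⟩, h'⟩)

/-- The cost of a single-commodity flow over time is at least its value times the cost of a cheapest
path. -/
theorem pathCost_mul_excess_le (D : Problem V A) {storage : Bool} {s t : V} (hst : s ≠ t) {θ : ℝ}
    {g : A → ℝ → ℝ} (hg : D.IsFlowOverTime storage {s} {t} θ g) :
    (D.excess g t θ ≠ 0 → ∃ P, D.IsPath s t P) ∧
      D.pathCost s t * D.excess g t θ ≤ D.flowCost θ g := by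
  have hnet := hg.excess_horizon
  obtain ⟨x, hx0, hxP, hxs, hxt, hxc⟩ := D.exists_path_decomposition D.conservative
    (fun a => ∫ y, g a y) fun a => MeasureTheory.integral_nonneg (hg.nonneg a)
  rw [← hg.flowCost_eq] at hxc
  simp only [← hnet] at hxs hxt
  have ht0 : 0 ≤ D.excess g t θ :=
    hg.no_deficit t (by simpa using hst.symm) θ ⟨hg.horizon_nonneg, le_rfl⟩
  have hrow : ∀ v w, v ≠ s → x v w = 0 := by
    intro v w h
    have h1 := hg.no_deficit v (by simpa using h) θ ⟨hg.horizon_nonneg, le_rfl⟩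
    have := hxs v
    rw [max_eq_right (by linarith)] at this
    exact (Finset.sum_eq_zero_iff_of_nonneg fun w _ => hx0 v w).1 this w (Finset.mem_univ w)
  -- All net inflows sum to zero and only `s` and `t` can be unbalanced.
  have hs0 : D.excess g s θ = -D.excess g t θ := by
    have h1 := D.sum_netInflow fun a => ∫ y, g a y
    simp only [← hnet] at h1
    rw [Finset.sum_eq_add s t hst (fun v _ hv => hg.no_surplus v (by simpa using hv.1)
      (by simpa using hv.2)) (by simp) (by simp)] at h1
    linarith
  have hcol : ∀ v w, w ≠ t → x v w = 0 := by
    intro v w h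
    have h1 : D.excess g w θ ≤ 0 := by
      by_cases hw : w = s
      · rw [hw, hs0]; linarith
      · exact (hg.no_surplus w (by simpa using hw) (by simpa using h)).le
    have := hxt w
    rw [max_eq_right h1] at this
    exact (Finset.sum_eq_zero_iff_of_nonneg fun v _ => hx0 v w).1 this v (Finset.mem_univ v)
  have hval : x s t = D.excess g t θ := by
    have h1 := hxt t
    rwa [max_eq_left ht0, Finset.sum_eq_single s (fun v _ hv => hrow v t hv) (by simp)] at h1
  rw [Finset.sum_eq_single s (fun v _ hv => Finset.sum_eq_zero fun w _ => by
      rw [hrow v w hv, mul_zero]) (by simp),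
    Finset.sum_eq_single t (fun w _ hw => by rw [hcol s w hw, mul_zero]) (by simp), hval] at hxc
  exact ⟨fun h => hxP s t (hval ▸ h), hxc⟩

/-- If a transshipment over time sends a positive amount of flow from `s` to `t`, then it yields a
solution of the transportation problem that is not more expensive and uses the arc `(s, t)`. -/
theorem IsTransshipment.exists_isTransportation_pos {storage : Bool} {θ : ℝ} {f : A → ℝ → ℝ}
    (hf : D.IsTransshipment storage θ f) {s t : V} (hs : s ∈ D.sources) (ht : t ∈ D.sinks)
    (hst : D.SendsPositive θ f s t) :
    (s, t) ∈ D.bipartiteArcs ∧ ∃ x, D.IsTransportation x ∧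
      D.transportationCost x ≤ D.flowCost θ f ∧ 0 < x s t := by
  classical
  obtain ⟨g, hg, hsum, hpos⟩ := hst
  have hne : ∀ s ∈ D.sources, ∀ t ∈ D.sinks, s ≠ t := fun s hs t ht h =>
    Finset.disjoint_left.1 D.disjoint hs (h ▸ ht)
  have hint : ∀ p ∈ D.sources ×ˢ D.sinks, ∀ a, MeasureTheory.Integrable (g p.1 p.2 a) :=
    fun p hp a => (hg p.1 (Finset.mem_product.1 hp).1 p.2 (Finset.mem_product.1 hp).2).integrable a
  have hf' : f = fun a x => ∑ p ∈ D.sources ×ˢ D.sinks, g p.1 p.2 a x := by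
    funext a x
    rw [hsum, Finset.sum_product]
  have hexc : ∀ v, D.excess f v θ = ∑ s ∈ D.sources, ∑ t ∈ D.sinks, D.excess (g s t) v θ := by
    intro v
    rw [hf', D.excess_sum _ (g := fun p : V × V => g p.1 p.2) hint, Finset.sum_product]
  have hother : ∀ s ∈ D.sources, ∀ t ∈ D.sinks, ∀ v, v ≠ s → v ≠ t →
      D.excess (g s t) v θ = 0 := fun s hs t ht v h1 h2 =>
    (hg s hs t ht).no_surplus v (by simpa using h1) (by simpa using h2)
  have harcs : ∀ s ∈ D.sources, ∀ t ∈ D.sinks, D.excess (g s t) t θ ≠ 0 →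
      (s, t) ∈ D.bipartiteArcs := fun s hs t ht h =>
    ⟨hs, ht, (D.pathCost_mul_excess_le (hne s hs t ht) (hg s hs t ht)).1 h⟩
  have hsource : ∀ s ∈ D.sources, ∀ t ∈ D.sinks,
      D.excess (g s t) s θ = -D.excess (g s t) t θ := by
    intro s hs t ht
    have h1 := D.sum_netInflow fun a => ∫ y, g s t a y
    simp only [← (hg s hs t ht).excess_horizon] at h1
    rw [Finset.sum_eq_add s t (hne s hs t ht) (fun v _ hv => hother s hs t ht v hv.1 hv.2)
      (by simp) (by simp)] at h1
    linarith
  have hcost : D.flowCost θ f = ∑ s ∈ D.sources, ∑ t ∈ D.sinks, D.flowCost θ (g s t) := by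
    rw [hf.isFlow.flowCost_eq]
    have h1 : ∀ a, ∫ x, f a x = ∑ p ∈ D.sources ×ˢ D.sinks, ∫ x, g p.1 p.2 a x := by
      intro a
      rw [hf']
      exact MeasureTheory.integral_finsetSum _ fun p hp => hint p hp a
    simp only [h1, Finset.mul_sum]
    rw [Finset.sum_comm, Finset.sum_product]
    exact Finset.sum_congr rfl fun s hs => Finset.sum_congr rfl fun t ht =>
      (hg s hs t ht).flowCost_eq.symm
  -- The solution ships from `s` to `t` exactly what the summand `g s t` delivers.
  refine ⟨harcs s hs t ht hpos.ne', fun s t => D.excess (g s t) t θ, ⟨?_, ?_, ?_⟩, ?_, hpos⟩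
  · intro s t hst
    exact (hg s hst.1 t hst.2.1).no_deficit t (by simpa using (hne s hst.1 t hst.2.1).symm) θ
      ⟨hf.isFlow.horizon_nonneg, le_rfl⟩
  · intro s hs
    have h1 := hf.source s hs
    rw [hexc, Finset.sum_eq_single s (fun s' hs' h => Finset.sum_eq_zero fun t ht =>
      hother s' hs' t ht s h.symm (hne s hs t ht)) (fun h => absurd hs h),
      Finset.sum_congr rfl (hsource s hs), Finset.sum_neg_distrib, neg_inj] at h1
    rw [← h1, Finset.sum_filter]
    refine Finset.sum_congr rfl fun t ht => ?_
    by_cases h : D.excess (g s t) t θ = 0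
    · simp [h]
    · rw [if_pos (harcs s hs t ht h)]
  · intro t ht
    have h1 := hf.sink t ht
    rw [hexc, Finset.sum_congr rfl fun s hs => Finset.sum_eq_single t (fun t' ht' h =>
      hother s hs t' ht' t (hne s hs t ht).symm h.symm) (fun h => absurd ht h)] at h1
    rw [Finset.sum_neg_distrib, ← neg_neg (D.b t), ← h1, neg_inj, Finset.sum_filter]
    refine Finset.sum_congr rfl fun s hs => ?_
    by_cases h : D.excess (g s t) t θ = 0
    · simp [h]
    · rw [if_pos (harcs s hs t ht h)]
  · rw [hcost, transportationCost_eq]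
    refine Finset.sum_le_sum fun s hs => Finset.sum_le_sum fun t ht => ?_
    have h1 := (D.pathCost_mul_excess_le (hne s hs t ht) (hg s hs t ht)).2
    split_ifs with h
    · exact h1
    -- A summand without an `s`-`t`-path delivers nothing; the cost bound then says that its cost is
    -- non-negative.
    · have h2 : D.excess (g s t) t θ = 0 := by
        by_contra h'
        exact h (harcs s hs t ht h')
      rwa [h2, mul_zero] at h1

end FromFlow

end Problem

end TransOverTime

namespace TransOverTime

/-! ### From transportation solutions to transshipments over time. -/

namespace Problem

variable {V A : Type*} [Fintype V] [Fintype A] {D : Problem V A}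

/-- A solution of the transportation problem yields a transshipment over time of the same cost,
which sends flow along cheapest paths at constant rates. -/
theorem IsTransportation.exists_isTransshipment {x : V → V → ℝ} (hx : D.IsTransportation x)
    (storage : Bool) :
    ∃ θ f, D.IsTransshipment storage θ f ∧ D.flowCost θ f = D.transportationCost x ∧
      ∀ s t, (s, t) ∈ D.bipartiteArcs → 0 < x s t → D.SendsPositive θ f s t := by
  classical
  have hpath : ∀ s t, ∃ P, (s, t) ∈ D.bipartiteArcs →
      D.IsPath s t P ∧ D.listCost P = D.pathCost s t := by
    intro s t
    by_cases h : (s, t) ∈ D.bipartiteArcs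
    · obtain ⟨P, hP⟩ := (D.exists_isPath_listCost_eq s t h.2.2).1
      exact ⟨P, fun _ => hP⟩
    · exact ⟨[], fun h' => absurd h' h⟩
  choose P hP using hpath
  let X : V → V → ℝ := fun s t => if (s, t) ∈ D.bipartiteArcs then x s t else 0
  have hX0 : ∀ s t, 0 ≤ X s t := by
    intro s t
    dsimp only [X]
    split_ifs with h
    · exact hx.nonneg s t h
    · exact le_rfl
  have hXsource : ∀ s ∈ D.sources, ∑ t ∈ D.sinks, X s t = D.b s := fun s hs => by
    rw [← hx.source s hs, Finset.sum_filter]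
  have hXsink : ∀ t ∈ D.sinks, ∑ s ∈ D.sources, X s t = -D.b t := fun t ht => by
    rw [← hx.sink t ht, Finset.sum_neg_distrib, neg_neg, Finset.sum_filter]
  have hne : ∀ s ∈ D.sources, ∀ t ∈ D.sinks, s ≠ t := fun s hs t ht h =>
    Finset.disjoint_left.1 D.disjoint hs (h ▸ ht)
  -- Sending each `X s t` at rate `X s t / T` loads any arc at rate at most `K / T` in total.
  set K : ℝ := ∑ s ∈ D.sources, ∑ t ∈ D.sinks, X s t * (P s t).length with hK
  have hK0 : 0 ≤ K := Finset.sum_nonneg fun s _ => Finset.sum_nonneg fun t _ =>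
    mul_nonneg (hX0 s t) (Nat.cast_nonneg _)
  -- The sum dominates every `K / D.capacity a`, and the 1 keeps `T` positive even if `K = 0`.
  set T : ℝ := 1 + ∑ a, K / D.capacity a with hT
  have hKa : ∀ a, 0 ≤ K / D.capacity a := fun a => div_nonneg hK0 (D.capacity_pos a).le
  have hTpos : 0 < T := by
    have := Finset.sum_nonneg fun a (_ : a ∈ Finset.univ) => hKa a
    linarith
  have hKT : ∀ a, K / T ≤ D.capacity a := by
    intro a
    have h1 := Finset.single_le_sum (fun a _ => hKa a) (Finset.mem_univ a)
    have h2 : K / D.capacity a ≤ T := by linarith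
    rwa [div_le_iff₀ hTpos, mul_comm, ← div_le_iff₀ (D.capacity_pos a)]
  -- Adding up all transit times is wasteful but leaves time for the last unit to arrive on every
  -- path.
  set θ : ℝ := T + ∑ s ∈ D.sources, ∑ t ∈ D.sinks, D.listTransit (P s t) with hθ
  have htransit : ∀ s ∈ D.sources, ∀ t ∈ D.sinks, D.listTransit (P s t) + T ≤ θ := by
    intro s hs t ht
    have h1 := Finset.single_le_sum (f := fun t => D.listTransit (P s t))
      (fun t _ => D.listTransit_nonneg _) ht
    have h2 := Finset.single_le_sum (f := fun s => ∑ t ∈ D.sinks, D.listTransit (P s t))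
      (fun s _ => Finset.sum_nonneg fun t _ => D.listTransit_nonneg _) hs
    linarith
  have hTθ : T ≤ θ := by
    have := Finset.sum_nonneg fun s (_ : s ∈ D.sources) => Finset.sum_nonneg
      fun t (_ : t ∈ D.sinks) => D.listTransit_nonneg (P s t)
    linarith
  have hθ0 : 0 ≤ θ := hTpos.le.trans hTθ
  have hρ0 : ∀ s t, 0 ≤ X s t / T := fun s t => div_nonneg (hX0 s t) hTpos.le
  let g : V → V → A → ℝ → ℝ := fun s t => D.pathFlow (X s t / T) T 0 (P s t)
  let f : A → ℝ → ℝ := fun a y => ∑ p ∈ D.sources ×ˢ D.sinks, g p.1 p.2 a y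
  have hg0 : ∀ s t a y, 0 ≤ g s t a y := fun s t a y => D.pathFlow_nonneg (hρ0 s t) _ _ _ _ _
  have hgint : ∀ s t a, MeasureTheory.Integrable (g s t a) :=
    fun s t a => D.integrable_pathFlow _ _ _ _ _
  have hgzero : ∀ s ∈ D.sources, ∀ t ∈ D.sinks, ∀ a, ∀ y ∉ Set.Ico 0 (θ - D.transit a),
      g s t a y = 0 := fun s hs t ht a y hy =>
    D.pathFlow_eq_zero le_rfl (by linarith [htransit s hs t ht]) hy
  have hfcap : ∀ a y, f a y ≤ D.capacity a := by
    intro a y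
    refine le_trans ?_ (hKT a)
    rw [hK, Finset.sum_div]
    simp only [f]
    rw [Finset.sum_product]
    refine Finset.sum_le_sum fun s _ => ?_
    rw [Finset.sum_div]
    refine Finset.sum_le_sum fun t _ => ?_
    have := D.pathFlow_le (hρ0 s t) T 0 (P s t) a y
    rwa [mul_div_right_comm]
  have hgcap : ∀ s ∈ D.sources, ∀ t ∈ D.sinks, ∀ a y, g s t a y ≤ D.capacity a :=
    fun s hs t ht a y => (Finset.single_le_sum (f := fun p : V × V => g p.1 p.2 a y)
      (fun p _ => hg0 p.1 p.2 a y) (Finset.mem_product.2 ⟨hs, ht⟩ :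
        (s, t) ∈ D.sources ×ˢ D.sinks)).trans (hfcap a y)
  have hgexc : ∀ s t v r, D.excess (g s t) v r =
      (if v = t then Network.amountUntil (X s t / T) T (D.listTransit (P s t)) r else 0) -
        (if v = s then Network.amountUntil (X s t / T) T 0 r else 0) := by
    intro s t v r
    by_cases h : (s, t) ∈ D.bipartiteArcs
    · have := D.excess_pathFlow (ρ := X s t / T) (T := T) le_rfl (hP s t h).1.1 v r
      rwa [zero_add] at this
    -- Off `D.bipartiteArcs` the list `P s t` is arbitrary and need not be a walk, but its rate is
    -- zero.
    · have h0 : X s t / T = 0 := by simp [X, h]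
      have h1 : ∀ a y, g s t a y = 0 := fun a y =>
        le_antisymm ((D.pathFlow_le (hρ0 s t) T 0 (P s t) a y).trans (by rw [h0, zero_mul]))
          (hg0 s t a y)
      simp [Network.excess, h1, h0, Network.amountUntil]
  have hgexcθ : ∀ s ∈ D.sources, ∀ t ∈ D.sinks, ∀ v, D.excess (g s t) v θ =
      (if v = t then X s t else 0) - (if v = s then X s t else 0) := by
    intro s hs t ht v
    rw [hgexc, Network.amountUntil_of_le hTpos.le (htransit s hs t ht),
      Network.amountUntil_of_le hTpos.le (by linarith), div_mul_cancel₀ _ hTpos.ne']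
  have hgnonneg : ∀ s t v r, v ≠ s → 0 ≤ D.excess (g s t) v r := by
    intro s t v r hv
    rw [hgexc, if_neg hv, sub_zero]
    split_ifs
    · exact Network.amountUntil_nonneg (hρ0 s t) _ _ _
    · exact le_rfl
  have hgother : ∀ s t v r, v ≠ s → v ≠ t → D.excess (g s t) v r = 0 := by
    intro s t v r h1 h2
    rw [hgexc, if_neg h1, if_neg h2, sub_zero]
  have hgflow : ∀ s ∈ D.sources, ∀ t ∈ D.sinks, D.IsFlowOverTime true {s} {t} θ (g s t) := by
    intro s hs t ht
    exact
      { horizon_nonneg := hθ0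
        measurable := fun a => (hgint s t a).aestronglyMeasurable.aemeasurable
        eq_zero := hgzero s hs t ht
        nonneg := hg0 s t
        le_capacity := hgcap s hs t ht
        no_deficit := fun v hv r _ => hgnonneg s t v r (by simpa using hv)
        no_surplus := fun v h1 h2 => hgother s t v θ (by simpa using h1) (by simpa using h2)
        no_storage := fun h => by simp at h }
  have hfexc : ∀ v r, D.excess f v r = ∑ s ∈ D.sources, ∑ t ∈ D.sinks, D.excess (g s t) v r := by
    intro v r
    rw [← Finset.sum_product']
    exact D.excess_sum _ (g := fun p : V × V => g p.1 p.2) (fun p _ => hgint p.1 p.2) v r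
  have hfother : ∀ v, v ∉ D.sources → v ∉ D.sinks → ∀ r, D.excess f v r = 0 := by
    intro v h1 h2 r
    rw [hfexc]
    exact Finset.sum_eq_zero fun s hs => Finset.sum_eq_zero fun t ht =>
      hgother s t v r (fun h => h1 (h ▸ hs)) (fun h => h2 (h ▸ ht))
  have hfflow : D.IsFlowOverTime storage D.sources D.sinks θ f :=
    { horizon_nonneg := hθ0
      measurable := fun a => (MeasureTheory.integrable_finsetSum _ fun p _ =>
        hgint p.1 p.2 a).aestronglyMeasurable.aemeasurable
      eq_zero := fun a y hy => Finset.sum_eq_zero fun p hp =>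
        hgzero p.1 (Finset.mem_product.1 hp).1 p.2 (Finset.mem_product.1 hp).2 a y hy
      nonneg := fun a y => Finset.sum_nonneg fun p _ => hg0 p.1 p.2 a y
      le_capacity := hfcap
      no_deficit := fun v hv r _ => by
        rw [hfexc]
        exact Finset.sum_nonneg fun s hs => Finset.sum_nonneg fun t _ =>
          hgnonneg s t v r fun h => hv (h ▸ hs)
      no_surplus := fun v h1 h2 => hfother v h1 h2 θ
      no_storage := fun _ v h1 h2 r _ => hfother v h1 h2 r }
  refine ⟨θ, f, ⟨hfflow, fun v hv => ?_, fun v hv => ?_⟩, ?_, fun s t hst hpos => ?_⟩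
  · rw [hfexc, ← hXsource v hv, ← Finset.sum_neg_distrib]
    rw [Finset.sum_eq_single v (fun s hs h => Finset.sum_eq_zero fun t ht =>
      hgother s t v θ h.symm (hne v hv t ht)) (fun h => absurd hv h)]
    refine Finset.sum_congr rfl fun t ht => ?_
    rw [hgexcθ v hv t ht, if_neg (hne v hv t ht), if_pos rfl, zero_sub]
  · rw [hfexc, ← hXsink v hv]
    refine Finset.sum_congr rfl fun s hs => ?_
    rw [Finset.sum_eq_single v (fun t ht h => hgother s t v θ (hne s hs v hv).symm h.symm)
      (fun h => absurd hv h), hgexcθ s hs v hv, if_pos rfl, if_neg (hne s hs v hv).symm, sub_zero]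
  · rw [hfflow.flowCost_eq]
    have h1 : ∀ a, ∫ y, f a y = ∑ p ∈ D.sources ×ˢ D.sinks, ∫ y, g p.1 p.2 a y :=
      fun a => MeasureTheory.integral_finsetSum _ fun p _ => hgint p.1 p.2 a
    simp only [h1, Finset.mul_sum]
    rw [Finset.sum_comm, Finset.sum_product, transportationCost_eq]
    refine Finset.sum_congr rfl fun s _ => Finset.sum_congr rfl fun t _ => ?_
    rw [D.cost_pathFlow hTpos.le, div_mul_cancel₀ _ hTpos.ne']
    by_cases h : (s, t) ∈ D.bipartiteArcs
    · simp [X, h, (hP s t h).2]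
    · simp [X, h]
  · refine ⟨g, hgflow, fun a y => Finset.sum_product _ _ _, ?_⟩
    rw [hgexcθ s hst.1 t hst.2.1, if_pos rfl, if_neg (hne s hst.1 t hst.2.1).symm, sub_zero]
    simpa [X, hst] using hpos

end Problem

end TransOverTime

/-! ### Combining both directions. -/

theorem mainTheorem3 {V A : Type*} [Fintype V] [Fintype A] (D : TransOverTime.Problem V A)
    (storage : Bool) :
    ((∃ x, D.IsTransportation x) ↔ ∃ θ f, D.IsTransshipment storage θ f) ∧
    ((∃ x, D.IsTransportation x) →
      ∃ z, IsLeast D.transportationCosts z ∧ IsLeast (D.transshipmentCosts storage) z) ∧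
    ∀ s ∈ D.sources, ∀ t ∈ D.sinks,
      (∃ θ f, D.IsMinCostTransshipment storage θ f ∧ D.SendsPositive θ f s t) ↔
        (s, t) ∈ D.bipartiteArcs ∧ ∃ x, D.IsOptimalTransportation x ∧ 0 < x s t := by
  refine ⟨⟨?_, ?_⟩, ?_, fun s hs t ht => ⟨?_, ?_⟩⟩
  · rintro ⟨x, hx⟩
    obtain ⟨θ, f, hf, -⟩ := hx.exists_isTransshipment storage
    exact ⟨θ, f, hf⟩
  · rintro ⟨θ, f, hf⟩
    obtain ⟨x, hx, -⟩ := hf.exists_isTransportation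
    exact ⟨x, hx⟩
  · intro h
    obtain ⟨x, hx, hmin⟩ := D.exists_isOptimalTransportation h
    obtain ⟨θ, f, hf, hcost, -⟩ := hx.exists_isTransshipment storage
    refine ⟨D.transportationCost x, ⟨⟨x, hx, rfl⟩, ?_⟩, ⟨⟨θ, f, hf, hcost⟩, ?_⟩⟩
    · rintro _ ⟨x', hx', rfl⟩
      exact hmin x' hx'
    · rintro _ ⟨θ', f', hf', rfl⟩
      obtain ⟨x', hx', hle⟩ := hf'.exists_isTransportation
      exact (hmin x' hx').trans hle
  · rintro ⟨θ, f, ⟨hf, hmin⟩, hpos⟩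
    obtain ⟨hst, x, hx, hle, hxpos⟩ := hf.exists_isTransportation_pos hs ht hpos
    refine ⟨hst, x, ⟨hx, fun x' hx' => ?_⟩, hxpos⟩
    obtain ⟨θ', f', hf', hcost, -⟩ := hx'.exists_isTransshipment storage
    -- `x` costs at most as much as `f`, which costs at most as much as the transshipment built from
    -- `x'`, whose cost is that of `x'`.
    exact hle.trans ((hmin θ' f' hf').trans hcost.le)
  · rintro ⟨hst, x, ⟨hx, hmin⟩, hxpos⟩
    obtain ⟨θ, f, hf, hcost, hsend⟩ := hx.exists_isTransshipment storage
    refine ⟨θ, f, ⟨hf, fun θ' f' hf' => ?_⟩, hsend s t hst hxpos⟩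
    obtain ⟨x', hx', hle⟩ := hf'.exists_isTransportation
    exact hcost.le.trans ((hmin x' hx').trans hle)
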